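/- Let $X_1,\dots,X_n$ be independent random variables with values in a Polish space $\mathcal X$, and let $\mathcal S$ be a nonempty countable class of measurable functions $s=(s^1,\dots,s^n)$ from $\mathcal X$ into $[-1,1]^n$ such that $\mathbb E(s^k(X_k))=0$ for every $s\in\mathcal S$ and every $k\in\{1,\dots,n\}$. For $s\in\mathcal S$ set $S_n(s)=s^1(X_1)+\dots+s^n(X_n)$, and let $$Z=\sup\{S_n(s):s\in\mathcal S\},\qquad V_n=\sup_{s\in\mathcal S}\operatorname{Var} S_n(s).$$ Then $$\operatorname{Var} Z\le V_n+2\,\mathbb E(Z).$$ -/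

import Mathlib

open MeasureTheory ProbabilityTheory

noncomputable section

namespace EmpiricalProcess

variable {Ω 𝒳 : Type*} {n : ℕ}

/-- The sum `S_n(s) = s¹(X₁) + ⋯ + sⁿ(Xₙ)` attached to a function `s = (s¹, …, sⁿ)` on `𝒳`
with `n` real components (indexed by `Fin n`). -/
def partialSum (X : Fin n → Ω → 𝒳) (s : 𝒳 → Fin n → ℝ) (ω : Ω) : ℝ :=
  ∑ k, s (X k ω) k

/-- The supremum `Z = sup {S_n(s) : s ∈ 𝒮}`, taken pointwise on `Ω`. For a nonempty class of
functions with values in `[-1, 1]ⁿ` it is the supremum of a nonempty subset of `[-n, n]`. -/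
def supremum (X : Fin n → Ω → 𝒳) (𝒮 : Set (𝒳 → Fin n → ℝ)) (ω : Ω) : ℝ :=
  ⨆ s : 𝒮, partialSum X s ω

/-- The maximal variance `V_n = sup {Var S_n(s) : s ∈ 𝒮}`. For a nonempty class of measurable
functions with values in `[-1, 1]ⁿ` it is the supremum of a nonempty subset of `[0, n²]`. -/
def maxVariance [MeasurableSpace Ω] (μ : Measure Ω) (X : Fin n → Ω → 𝒳)
    (𝒮 : Set (𝒳 → Fin n → ℝ)) : ℝ :=
  ⨆ s : 𝒮, variance (partialSum X s) μ

end EmpiricalProcess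

end

namespace EmpiricalProcess

/-! By the Efron–Stein inequality, the variance of the supremum is at most the sum over `k` of the
mean variance in the `k`-th coordinate alone. For a finite subclass let `τ` be a measurable
maximizer. With the other coordinates frozen, the supremum is `a (τ x) + φ (τ x) x`, the `φ i` being
centred and bounded by 1, and `variance_le_of_forall_le_selection` bounds its variance by the mean
of `∫ φ (τ x) ^ 2 + 2 φ (τ x) x`. Summed over `k`, the squares give the variance of the selected
competitor, at most `V_n`, while the linear terms add up to exactly twice the supremum
(`variance_selection_le`). Countable classes follow by exhausting them with finite ones. -/

theorem _root_.MeasureTheory.MeasurePreserving.integral_comp_measurable {α β : Type*}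
    [MeasurableSpace α] [MeasurableSpace β] {μ : Measure α} {ν : Measure β} {φ : α → β}
    (hφ : MeasurePreserving φ μ ν) {g : β → ℝ} (hg : Measurable g) :
    ∫ x, g (φ x) ∂μ = ∫ y, g y ∂ν := by
  rw [← hφ.map_eq, integral_map hφ.aemeasurable hg.aestronglyMeasurable]

theorem integrable_of_abs_le {α : Type*} [MeasurableSpace α] {μ : Measure α} [IsFiniteMeasure μ]
    {f : α → ℝ} (hf : Measurable f) (C : ℝ) (hC : ∀ x, |f x| ≤ C) : Integrable f μ :=
  Integrable.of_bound hf.aestronglyMeasurable C (ae_of_all μ hC)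

theorem memLp_two_of_abs_le {α : Type*} [MeasurableSpace α] {μ : Measure α} [IsFiniteMeasure μ]
    {f : α → ℝ} (hf : Measurable f) (C : ℝ) (hC : ∀ x, |f x| ≤ C) : MemLp f 2 μ :=
  MemLp.of_bound hf.aestronglyMeasurable C (ae_of_all μ hC)

theorem abs_integral_le_of_abs_le {α : Type*} [MeasurableSpace α] {μ : Measure α}
    [IsProbabilityMeasure μ] {f : α → ℝ} {C : ℝ} (hC : ∀ x, |f x| ≤ C) : |∫ x, f x ∂μ| ≤ C := by
  simpa using norm_integral_le_of_norm_le_const (μ := μ) (f := f) (C := C) (ae_of_all μ hC)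

theorem integrable_mul_of_memLp {α : Type*} [MeasurableSpace α] {μ : Measure α} {f g : α → ℝ}
    (hf : MemLp f 2 μ) (hg : MemLp g 2 μ) : Integrable (fun x => f x * g x) μ :=
  hf.integrable_mul hg

/-! ### Swapping coordinates between two independent samples -/

section Mix

variable {ι 𝒳 : Type*} [DecidableEq ι]

/-- From a double sample, pick the second copy on `A` and the first one off `A`. -/
def mix (A : Finset ι) (w : ι → 𝒳 × 𝒳) : ι → 𝒳 := fun i => if i ∈ A then (w i).2 else (w i).1

/-- Exchange the two copies of a double sample on `A`. -/
def exchange (A : Finset ι) (w : ι → 𝒳 × 𝒳) : ι → 𝒳 × 𝒳 :=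
  fun i => if i ∈ A then (w i).swap else w i

theorem update_mix_empty (k : ι) (w : ι → 𝒳 × 𝒳) :
    Function.update (mix ∅ w) k (w k).2 = mix {k} w := by
  funext i
  by_cases hi : i = k
  · subst hi; simp [mix]
  · simp [mix, hi]

theorem mix_exchange_empty (A : Finset ι) (w : ι → 𝒳 × 𝒳) : mix ∅ (exchange A w) = mix A w := by
  funext i
  by_cases hi : i ∈ A <;> simp [mix, exchange, hi]

theorem mix_exchange_singleton {A : Finset ι} {k : ι} (hk : k ∉ A) (w : ι → 𝒳 × 𝒳) :
    mix {k} (exchange A w) = mix (insert k A) w := by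
  funext i
  by_cases hik : i = k
  · subst hik; simp [mix, exchange, hk]
  · by_cases hi : i ∈ A <;> simp [mix, exchange, hi, hik]

theorem mix_singleton_exchange {A : Finset ι} {k : ι} (hk : k ∉ A) (w : ι → 𝒳 × 𝒳) :
    mix A (exchange {k} w) = mix (insert k A) w := by
  funext i
  by_cases hik : i = k
  · subst hik; simp [mix, exchange, hk]
  · by_cases hi : i ∈ A <;> simp [mix, exchange, hi, hik]

theorem mix_insert_exchange {A : Finset ι} {k : ι} (hk : k ∉ A) (w : ι → 𝒳 × 𝒳) :
    mix (insert k A) (exchange {k} w) = mix A w := by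
  funext i
  by_cases hik : i = k
  · subst hik; simp [mix, exchange, hk]
  · by_cases hi : i ∈ A <;> simp [mix, exchange, hi, hik]

theorem measurable_update_prod [MeasurableSpace 𝒳] (k : ι) :
    Measurable fun p : (ι → 𝒳) × 𝒳 => Function.update p.1 k p.2 := by
  rw [measurable_pi_iff]
  intro i
  by_cases hi : i = k
  · subst hi; simpa using measurable_snd
  · simpa [hi, Function.comp_def] using (measurable_pi_apply i).comp measurable_fst

end Mix

/-! ### Efron–Stein inequality -/

section DoubleSample

variable {ι 𝒳 : Type*} [Fintype ι] [DecidableEq ι] [MeasurableSpace 𝒳]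
  (ν : ι → Measure 𝒳) [∀ i, IsProbabilityMeasure (ν i)]

/-- The law of a pair of independent samples, grouped by coordinates. -/
noncomputable abbrev doubleMeasure : Measure (ι → 𝒳 × 𝒳) :=
  Measure.pi fun i => (ν i).prod (ν i)

theorem measurePreserving_mix (A : Finset ι) :
    MeasurePreserving (mix A) (doubleMeasure ν) (Measure.pi ν) := by
  have h : ∀ i, MeasurePreserving (fun p : 𝒳 × 𝒳 => if i ∈ A then p.2 else p.1)
      ((ν i).prod (ν i)) (ν i) := by
    intro i
    by_cases hi : i ∈ A
    · simpa only [hi, if_true] using measurePreserving_snd (μ := ν i) (ν := ν i)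
    · simpa only [hi, if_false] using measurePreserving_fst (μ := ν i) (ν := ν i)
  exact measurePreserving_pi _ _ h

theorem measurePreserving_exchange (A : Finset ι) :
    MeasurePreserving (exchange A) (doubleMeasure ν) (doubleMeasure ν) := by
  have h : ∀ i, MeasurePreserving (fun p : 𝒳 × 𝒳 => if i ∈ A then p.swap else p)
      ((ν i).prod (ν i)) ((ν i).prod (ν i)) := by
    intro i
    by_cases hi : i ∈ A
    · simpa only [hi, if_true] using Measure.measurePreserving_swap (μ := ν i) (ν := ν i)
    · simp only [hi, if_false]
      exact MeasurePreserving.id _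
  exact measurePreserving_pi _ _ h

theorem measurePreserving_mix_prod :
    MeasurePreserving (fun w : ι → 𝒳 × 𝒳 => (mix ∅ w, mix Finset.univ w)) (doubleMeasure ν)
      ((Measure.pi ν).prod (Measure.pi ν)) := by
  have h := measurePreserving_arrowProdEquivProdArrow 𝒳 𝒳 ι ν ν
  convert h using 1
  funext w
  ext <;> simp [mix, MeasurableEquiv.arrowProdEquivProdArrow, Equiv.arrowProdEquivProdArrow]

theorem measurePreserving_mix_eval (k : ι) :
    MeasurePreserving (fun w : ι → 𝒳 × 𝒳 => (mix ∅ w, (w k).2)) (doubleMeasure ν)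
      ((Measure.pi ν).prod (ν k)) := by
  have h := ((MeasurePreserving.id (Measure.pi ν)).prod
    (measurePreserving_eval ν k)).comp (measurePreserving_mix_prod ν)
  convert h using 1
  funext w
  simp [mix]

theorem measurePreserving_update (k : ι) :
    MeasurePreserving (fun p : (ι → 𝒳) × 𝒳 => Function.update p.1 k p.2)
      ((Measure.pi ν).prod (ν k)) (Measure.pi ν) := by
  refine ⟨measurable_update_prod k, ?_⟩
  rw [← (measurePreserving_mix_eval ν k).map_eq, Measure.map_map (measurable_update_prod k)
    (measurePreserving_mix_eval ν k).measurable, ← (measurePreserving_mix ν {k}).map_eq]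
  congr 1
  funext w
  exact update_mix_empty k w

/-- The difference telescopes as coordinates are replaced one at a time. Exchanging the copies of
coordinate `k` turns each term into half the mean of a product of two differences, to which `2uv ≤
u² + v²` applies; both squares have the same mean. -/
theorem integral_mul_sub_mix_le {f : (ι → 𝒳) → ℝ} (hf : Measurable f) {C : ℝ}
    (hC : ∀ x, |f x| ≤ C) (A : Finset ι) :
    ∫ w, f (mix ∅ w) * (f (mix ∅ w) - f (mix A w)) ∂(doubleMeasure ν) ≤
      ∑ k ∈ A, (1 / 2) * ∫ w, (f (mix ∅ w) - f (mix {k} w)) ^ 2 ∂(doubleMeasure ν) := by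
  have hm : ∀ B : Finset ι, Measurable fun w : ι → 𝒳 × 𝒳 => f (mix B w) := fun B =>
    hf.comp (measurePreserving_mix ν B).measurable
  have hmem : ∀ B : Finset ι, MemLp (fun w : ι → 𝒳 × 𝒳 => f (mix B w)) 2 (doubleMeasure ν) :=
    fun B => memLp_two_of_abs_le (hm B) C fun _ => hC _
  have hsubm : ∀ B D : Finset ι, MemLp (fun w : ι → 𝒳 × 𝒳 => f (mix B w) - f (mix D w)) 2
      (doubleMeasure ν) := fun B D => (hmem B).sub (hmem D)
  induction A using Finset.induction_on with
  | empty => simp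
  | insert k A hk ih =>
    rw [Finset.sum_insert hk]
    have hsplit : ∫ w, f (mix ∅ w) * (f (mix ∅ w) - f (mix (insert k A) w)) ∂(doubleMeasure ν) =
        ∫ w, f (mix ∅ w) * (f (mix A w) - f (mix (insert k A) w)) ∂(doubleMeasure ν) +
        ∫ w, f (mix ∅ w) * (f (mix ∅ w) - f (mix A w)) ∂(doubleMeasure ν) := by
      rw [← integral_add (integrable_mul_of_memLp (hmem ∅) (hsubm _ _))
        (integrable_mul_of_memLp (hmem ∅) (hsubm _ _))]
      exact integral_congr_ae (ae_of_all _ fun w => by ring)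
    have hswap : ∫ w, f (mix ∅ w) * (f (mix A w) - f (mix (insert k A) w)) ∂(doubleMeasure ν) =
        ∫ w, f (mix {k} w) * (f (mix (insert k A) w) - f (mix A w)) ∂(doubleMeasure ν) := by
      rw [← (measurePreserving_exchange ν {k}).integral_comp_measurable
        (g := fun w => f (mix ∅ w) * (f (mix A w) - f (mix (insert k A) w)))
        ((hm ∅).mul ((hm A).sub (hm (insert k A))))]
      simp only [mix_exchange_empty, mix_singleton_exchange hk,
        mix_insert_exchange hk]
    -- Exchanging the copies on `A`, which does not contain `k`, preserves the law.
    have hsq : ∫ w, (f (mix A w) - f (mix (insert k A) w)) ^ 2 ∂(doubleMeasure ν) =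
        ∫ w, (f (mix ∅ w) - f (mix {k} w)) ^ 2 ∂(doubleMeasure ν) := by
      rw [← (measurePreserving_exchange ν A).integral_comp_measurable
        (g := fun w => (f (mix ∅ w) - f (mix {k} w)) ^ 2)
        (((hm ∅).sub (hm {k})).pow_const 2)]
      simp only [mix_exchange_empty, mix_exchange_singleton hk]
    have hle : ∫ w, f (mix ∅ w) * (f (mix A w) - f (mix (insert k A) w)) ∂(doubleMeasure ν) +
        ∫ w, f (mix {k} w) * (f (mix (insert k A) w) - f (mix A w)) ∂(doubleMeasure ν) ≤
        (1 / 2) * ∫ w, (f (mix ∅ w) - f (mix {k} w)) ^ 2 ∂(doubleMeasure ν) +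
        (1 / 2) * ∫ w, (f (mix A w) - f (mix (insert k A) w)) ^ 2 ∂(doubleMeasure ν) := by
      rw [← integral_const_mul, ← integral_const_mul,
        ← integral_add (integrable_mul_of_memLp (hmem ∅) (hsubm _ _))
          (integrable_mul_of_memLp (hmem _) (hsubm _ _)),
        ← integral_add ((hsubm _ _).integrable_sq.const_mul _)
          ((hsubm _ _).integrable_sq.const_mul _)]
      refine integral_mono ((integrable_mul_of_memLp (hmem ∅) (hsubm _ _)).add
          (integrable_mul_of_memLp (hmem _) (hsubm _ _))) (((hsubm _ _).integrable_sq.const_mul _).add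
          ((hsubm _ _).integrable_sq.const_mul _)) fun w => ?_
      dsimp only [Pi.add_apply]
      nlinarith [sq_nonneg ((f (mix ∅ w) - f (mix {k} w)) -
        (f (mix A w) - f (mix (insert k A) w)))]
    linarith

/-- The **Efron–Stein inequality** for bounded functions, with independent copies. -/
theorem variance_le_sum_sq_update {f : (ι → 𝒳) → ℝ} (hf : Measurable f) {C : ℝ}
    (hC : ∀ x, |f x| ≤ C) :
    variance f (Measure.pi ν) ≤ ∑ k, (1 / 2) *
      ∫ p, (f p.1 - f (Function.update p.1 k p.2)) ^ 2 ∂((Measure.pi ν).prod (ν k)) := by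
  have hm : ∀ B : Finset ι, Measurable fun w : ι → 𝒳 × 𝒳 => f (mix B w) := fun B =>
    hf.comp (measurePreserving_mix ν B).measurable
  have hmem : ∀ B : Finset ι, MemLp (fun w : ι → 𝒳 × 𝒳 => f (mix B w)) 2 (doubleMeasure ν) :=
    fun B => memLp_two_of_abs_le (hm B) C fun _ => hC _
  have h := integral_mul_sub_mix_le ν hf hC Finset.univ
  -- `mix ∅ w` and `mix univ w` are independent with the same law, so the cross term is the squared
  -- mean.
  have hvar : variance f (Measure.pi ν) =
      ∫ w, f (mix ∅ w) * (f (mix ∅ w) - f (mix Finset.univ w)) ∂(doubleMeasure ν) := by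
    have h1 : ∫ w, f (mix ∅ w) * f (mix Finset.univ w) ∂(doubleMeasure ν) =
        (∫ x, f x ∂(Measure.pi ν)) * ∫ x, f x ∂(Measure.pi ν) := by
      rw [← integral_prod_mul, ← (measurePreserving_mix_prod ν).integral_comp_measurable
        (g := fun p => f p.1 * f p.2) (by fun_prop)]
    have h2 : ∫ w, f (mix ∅ w) ^ 2 ∂(doubleMeasure ν) = ∫ x, f x ^ 2 ∂(Measure.pi ν) :=
      (measurePreserving_mix ν ∅).integral_comp_measurable (hf.pow_const 2)
    simp only [mul_sub]
    rw [integral_sub (integrable_mul_of_memLp (hmem _) (hmem _))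
      (integrable_mul_of_memLp (hmem _) (hmem _)), h1,
      variance_eq_sub (memLp_two_of_abs_le hf C hC)]
    simp only [pow_two] at h2
    simp only [Pi.pow_apply, pow_two, h2]
  rw [hvar]
  refine h.trans_eq (Finset.sum_congr rfl fun k _ => ?_)
  congr 1
  rw [← (measurePreserving_mix_eval ν k).integral_comp_measurable
    (g := fun p => (f p.1 - f (Function.update p.1 k p.2)) ^ 2)
    (((hf.comp measurable_fst).sub (hf.comp (measurable_update_prod k))).pow_const 2)]
  simp only [update_mix_empty]

/-- The **Efron–Stein inequality** for bounded functions, with coordinatewise variances. -/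
theorem variance_le_sum_integral_variance_update {f : (ι → 𝒳) → ℝ} (hf : Measurable f) {C : ℝ}
    (hC : ∀ x, |f x| ≤ C) :
    variance f (Measure.pi ν) ≤ ∑ k, ∫ x, variance (fun y => f (Function.update x k y)) (ν k)
      ∂(Measure.pi ν) := by
  refine (variance_le_sum_sq_update ν hf hC).trans_eq (Finset.sum_congr rfl fun k _ => ?_)
  set u : (ι → 𝒳) × 𝒳 → ℝ := fun p => f (Function.update p.1 k p.2) with hu
  have hum : Measurable u := hf.comp (measurable_update_prod k)
  have hux : ∀ x, Measurable fun y => f (Function.update x k y) := fun x =>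
    hum.comp measurable_prodMk_left
  have hfst : Measurable fun p : (ι → 𝒳) × 𝒳 => f p.1 := hf.comp measurable_fst
  -- `T` is the conditional mean of `f` given the coordinates other than `k`.
  set T : (ι → 𝒳) → ℝ := fun x => ∫ y, f (Function.update x k y) ∂(ν k) with hT
  have hTm : Measurable T := hum.stronglyMeasurable.integral_prod_right.measurable
  have hTC : ∀ x, |T x| ≤ C := fun x => abs_integral_le_of_abs_le fun y => hC _
  have hTu : ∀ x y, T (Function.update x k y) = T x := fun x y => by simp [hT]
  have hu1 : MemLp u 2 ((Measure.pi ν).prod (ν k)) := memLp_two_of_abs_le hum C fun _ => hC _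
  have hu2 : MemLp (fun p : (ι → 𝒳) × 𝒳 => f p.1) 2 ((Measure.pi ν).prod (ν k)) :=
    memLp_two_of_abs_le hfst C fun _ => hC _
  have hTL : MemLp T 2 (Measure.pi ν) := memLp_two_of_abs_le hTm C hTC
  have huu : ∫ p, u p ^ 2 ∂((Measure.pi ν).prod (ν k)) = ∫ x, f x ^ 2 ∂(Measure.pi ν) :=
    (measurePreserving_update ν k).integral_comp_measurable (hf.pow_const 2)
  have hff : ∫ p : (ι → 𝒳) × 𝒳, f p.1 ^ 2 ∂((Measure.pi ν).prod (ν k)) =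
      ∫ x, f x ^ 2 ∂(Measure.pi ν) :=
    (measurePreserving_fst (μ := Measure.pi ν) (ν := ν k)).integral_comp_measurable
      (hf.pow_const 2)
  -- Given the other coordinates, `f p.1` and `u p` are independent with common mean `T`.
  have hfT : ∫ p, f p.1 * u p ∂((Measure.pi ν).prod (ν k)) =
      ∫ x, T x ^ 2 ∂(Measure.pi ν) := by
    rw [integral_prod _ (integrable_mul_of_memLp hu2 hu1)]
    simp only [integral_const_mul, hu]
    change ∫ x, f x * T x ∂(Measure.pi ν) = _
    rw [← (measurePreserving_update ν k).integral_comp_measurable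
      (g := fun x => f x * T x) (hf.mul hTm)]
    simp only [hTu]
    change ∫ p, u p * (T ∘ Prod.fst) p ∂((Measure.pi ν).prod (ν k)) = _
    rw [integral_prod _ (integrable_mul_of_memLp hu1
      (memLp_two_of_abs_le (hTm.comp measurable_fst) C fun p => hTC p.1))]
    simp only [Function.comp_apply, integral_mul_const, pow_two]
    rfl
  have hvar : ∀ x, variance (fun y => f (Function.update x k y)) (ν k) =
      ∫ y, u (x, y) ^ 2 ∂(ν k) - T x ^ 2 := fun x => by
    rw [variance_eq_sub (memLp_two_of_abs_le (hux x) C fun _ => hC _)]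
    simp only [Pi.pow_apply, hu, hT]
  simp only [hvar]
  rw [integral_sub hu1.integrable_sq.integral_prod_left hTL.integrable_sq,
    ← integral_prod _ hu1.integrable_sq, huu]
  have hexp : ∫ p, (f p.1 - u p) ^ 2 ∂((Measure.pi ν).prod (ν k)) =
      ∫ p, f p.1 ^ 2 ∂((Measure.pi ν).prod (ν k)) +
      ∫ p, u p ^ 2 ∂((Measure.pi ν).prod (ν k)) -
      2 * ∫ p, f p.1 * u p ∂((Measure.pi ν).prod (ν k)) := by
    rw [← integral_const_mul, ← integral_add hu2.integrable_sq hu1.integrable_sq,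
      ← integral_sub (f := fun p => f p.1 ^ 2 + u p ^ 2) (hu2.integrable_sq.add hu1.integrable_sq)
        ((integrable_mul_of_memLp hu2 hu1).const_mul 2)]
    refine integral_congr_ae (ae_of_all _ fun p => ?_)
    ring
  rw [hexp, huu, hff, hfT]
  ring

end DoubleSample

/-! ### Variance of a maximum in one variable -/

/-- Variance of a maximum in one random variable: `τ x` selects, among the affine competitors
`a i + φ i`, a maximal one at `x`. -/
theorem variance_le_of_forall_le_selection {𝒳 : Type*} [MeasurableSpace 𝒳] (ν : Measure 𝒳)
    [IsProbabilityMeasure ν] {a : ℕ → ℝ} {φ : ℕ → 𝒳 → ℝ} {τ : 𝒳 → ℕ} {A : ℝ}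
    (ha : ∀ i, |a i| ≤ A) (hφ : ∀ i, Measurable (φ i)) (hφ1 : ∀ i x, |φ i x| ≤ 1)
    (hφ0 : ∀ i, ∫ x, φ i x ∂ν = 0) (hτ : Measurable τ)
    (hmax : ∀ x x', a (τ x') + φ (τ x') x ≤ a (τ x) + φ (τ x) x) :
    variance (fun x => a (τ x) + φ (τ x) x) ν ≤
      ∫ x, (∫ y, φ (τ x) y ^ 2 ∂ν) + 2 * φ (τ x) x ∂ν := by
  have hφu : Measurable fun p : ℕ × 𝒳 => φ p.1 p.2 := measurable_from_prod_countable_right hφ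
  have ham : Measurable fun x => a (τ x) := (measurable_of_countable a).comp hτ
  have hΦ : Measurable fun p : 𝒳 × 𝒳 => φ (τ p.1) p.2 :=
    hφu.comp ((hτ.comp measurable_fst).prodMk measurable_snd)
  have hdm : Measurable fun x => φ (τ x) x := hφu.comp (hτ.prodMk measurable_id)
  have hai : Integrable (fun x => a (τ x)) ν := integrable_of_abs_le ham A fun x => ha _
  have hdi : Integrable (fun x => φ (τ x) x) ν := integrable_of_abs_le hdm 1 fun x => hφ1 _ _
  have hφi : ∀ i, Integrable (φ i) ν := fun i => integrable_of_abs_le (hφ i) 1 (hφ1 i)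
  have hsel : ∀ x, Integrable (fun x' => φ (τ x') x) ν := fun x =>
    integrable_of_abs_le (hΦ.comp measurable_prodMk_right) 1 fun x' => hφ1 _ _
  have hsq1 : ∀ i x, |φ i x ^ 2| ≤ 1 := fun i x => by
    rw [abs_pow]; exact pow_le_one₀ (abs_nonneg _) (hφ1 i x)
  set c := ∫ x, a (τ x) ∂ν
  set m := ∫ x, φ (τ x) x ∂ν
  -- `y x` and `w x` average over competitors selected at an independent point `x'`.
  set y : 𝒳 → ℝ := fun x => ∫ x', φ (τ x') x ∂ν with hy
  set w : 𝒳 → ℝ := fun x => ∫ x', φ (τ x') x ^ 2 ∂ν with hw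
  have hym : Measurable y := hΦ.stronglyMeasurable.integral_prod_left.measurable
  have hwm : Measurable w := (hΦ.pow_const 2).stronglyMeasurable.integral_prod_left.measurable
  have hvm : Measurable fun x => ∫ y, φ (τ x) y ^ 2 ∂ν :=
    (hΦ.pow_const 2).stronglyMeasurable.integral_prod_right.measurable
  have hy1 : ∀ x, |y x| ≤ 1 := fun x => abs_integral_le_of_abs_le fun x' => hφ1 _ _
  have hyi : Integrable y ν := integrable_of_abs_le hym 1 hy1
  have hwi : Integrable w ν :=
    integrable_of_abs_le hwm 1 fun x => abs_integral_le_of_abs_le fun x' => hsq1 _ _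
  have hvi : Integrable (fun x => ∫ y, φ (τ x) y ^ 2 ∂ν) ν :=
    integrable_of_abs_le hvm 1 fun x => abs_integral_le_of_abs_le fun x' => hsq1 _ _
  have hy0 : ∫ x, y x ∂ν = 0 := by
    rw [hy, integral_integral_swap (f := fun x x' => φ (τ x') x)
      (integrable_of_abs_le (hΦ.comp measurable_swap) 1 fun p => hφ1 _ _)]
    simp [hφ0]
  have hwv : ∫ x, w x ∂ν = ∫ x, ∫ y, φ (τ x) y ^ 2 ∂ν ∂ν := by
    rw [hw, integral_integral_swap (f := fun x x' => φ (τ x') x ^ 2)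
      (integrable_of_abs_le ((hΦ.pow_const 2).comp measurable_swap) 1 fun p => hsq1 _ _)]
  have hyw : ∀ x, y x ^ 2 ≤ w x := fun x => by
    have h := variance_nonneg (fun x' => φ (τ x') x) ν
    rw [variance_eq_sub (memLp_two_of_abs_le (f := fun x' => φ (τ x') x)
      (hΦ.comp measurable_prodMk_right) 1 fun x' => hφ1 _ _)] at h
    simpa using h
  have hz : ∫ x, (a (τ x) + φ (τ x) x) ∂ν = c + m := integral_add hai hdi
  -- Keep the competitor selected at `x` and integrate over the point: its centred part vanishes.
  have hup : ∀ x, a (τ x) ≤ c + m := fun x => by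
    rw [← hz]
    have h := integral_mono (μ := ν) ((integrable_const (a (τ x))).add (hφi (τ x)))
      (hai.add hdi) fun x' => hmax x' x
    simpa [integral_add (integrable_const (a (τ x))) (hφi (τ x)), hφ0] using h
  -- Keep the point `x` and average over the competitors selected at `x'`.
  have hlow : ∀ x, c + y x ≤ a (τ x) + φ (τ x) x := fun x => by
    have h := integral_mono (μ := ν) (hai.add (hsel x))
      (integrable_const (a (τ x) + φ (τ x) x)) fun x' => hmax x x'
    have h' := integral_add hai (hsel x)
    simp only [Pi.add_apply, integral_const, probReal_univ, one_smul] at h h'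
    linarith
  rw [variance_eq_integral (X := fun x => a (τ x) + φ (τ x) x) (ham.add hdm).aemeasurable, hz]
  have hzL : MemLp (fun x => a (τ x) + φ (τ x) x - (c + m)) 2 ν :=
    (memLp_two_of_abs_le (ham.add hdm) (A + 1) fun x =>
      (abs_add_le _ _).trans (add_le_add (ha _) (hφ1 _ _))).sub (memLp_const _)
  have hI : Integrable (fun x => w x + 2 * (a (τ x) + φ (τ x) x - c - y x)
      - m * (a (τ x) + φ (τ x) x - c - m + y x)) ν :=
    (hwi.add ((((hai.add hdi).sub (integrable_const c)).sub hyi).const_mul 2)).sub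
      (((((hai.add hdi).sub (integrable_const c)).sub (integrable_const m)).add hyi).const_mul m)
  calc ∫ x, (a (τ x) + φ (τ x) x - (c + m)) ^ 2 ∂ν
      ≤ ∫ x, (w x + 2 * (a (τ x) + φ (τ x) x - c - y x)
          - m * (a (τ x) + φ (τ x) x - c - m + y x)) ∂ν := by
        refine integral_mono hzL.integrable_sq hI fun x => ?_
        dsimp only
        have h1 := (abs_le.mp (hy1 x)).2
        have h2 := (abs_le.mp (hφ1 (τ x) x)).2
        -- Let `r` be the centred maximum. `hlow` says `r + m - y ≥ 0`; `hup` gives `r ≤ φ (τ x) x ≤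
        -- 1`, so `r + y ≤ 2`. Expanding `(r + m - y)(2 - r - y) ≥ 0` bounds `r²`, and `y² ≤ w`. The
        -- term with factor `m` has mean zero.
        have h3 := mul_nonneg (sub_nonneg.2 (hlow x))
          (show 0 ≤ 2 - ((a (τ x) + φ (τ x) x - (c + m)) + y x) by linarith [hup x])
        nlinarith [hyw x]
    _ = (∫ x, w x ∂ν) + 2 * m := by
        have hzi : Integrable (fun x => (2 - m) * (a (τ x) + φ (τ x) x)) ν :=
          (hai.add hdi).const_mul _
        have hyi' : Integrable (fun x => (-2 - m) * y x) ν := hyi.const_mul _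
        have hyc : Integrable (fun x => (-2 - m) * y x + (m * (c + m) - 2 * c)) ν :=
          hyi'.add (integrable_const _)
        have hzy : Integrable (fun x => (2 - m) * (a (τ x) + φ (τ x) x) +
            ((-2 - m) * y x + (m * (c + m) - 2 * c))) ν := hzi.add hyc
        have e : ∀ x, w x + 2 * (a (τ x) + φ (τ x) x - c - y x)
            - m * (a (τ x) + φ (τ x) x - c - m + y x) =
            w x + ((2 - m) * (a (τ x) + φ (τ x) x) + ((-2 - m) * y x + (m * (c + m) - 2 * c))) :=
          fun x => by ring
        simp only [e]
        rw [integral_add hwi hzy, integral_add hzi hyc, integral_add hyi' (integrable_const _),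
          integral_const_mul, integral_const_mul, hy0, hz]
        simp only [integral_const, probReal_univ, one_smul]
        ring
    _ = ∫ x, (∫ y, φ (τ x) y ^ 2 ∂ν) + 2 * φ (τ x) x ∂ν := by
        rw [integral_add hvi (hdi.const_mul 2), integral_const_mul, hwv]

/-! ### Maxima over a product space -/

/-- The variance bound for a measurably selected maximum over a product space. -/
theorem variance_selection_le {ι 𝒳 : Type*} [Fintype ι] [DecidableEq ι] [MeasurableSpace 𝒳]
    (ν : ι → Measure 𝒳) [∀ i, IsProbabilityMeasure (ν i)] {s : ℕ → 𝒳 → ι → ℝ}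
    (hs : ∀ i, Measurable (s i)) (hs1 : ∀ i x k, |s i x k| ≤ 1)
    (hs0 : ∀ i k, ∫ x, s i x k ∂(ν k) = 0) {τ : (ι → 𝒳) → ℕ} (hτ : Measurable τ)
    (hmax : ∀ x x', ∑ k, s (τ x') (x k) k ≤ ∑ k, s (τ x) (x k) k) {V : ℝ}
    (hV : ∀ i, ∑ k, ∫ x, s i x k ^ 2 ∂(ν k) ≤ V) :
    variance (fun x => ∑ k, s (τ x) (x k) k) (Measure.pi ν) ≤
      V + 2 * ∫ x, ∑ k, s (τ x) (x k) k ∂(Measure.pi ν) := by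
  have hsk : ∀ i k, Measurable fun x => s i x k := fun i k =>
    (measurable_pi_apply k).comp (hs i)
  have hsu : ∀ k, Measurable fun p : ℕ × 𝒳 => s p.1 p.2 k := fun k =>
    measurable_from_prod_countable_right fun i => hsk i k
  have hdm : ∀ k, Measurable fun x : ι → 𝒳 => s (τ x) (x k) k := fun k =>
    (hsu k).comp (hτ.prodMk (measurable_pi_apply k))
  have hsum : ∀ (T : Finset ι) i (x : ι → 𝒳), |∑ k ∈ T, s i (x k) k| ≤ T.card := fun T i x => by
    refine (Finset.abs_sum_le_sum_abs _ _).trans ((Finset.sum_le_sum fun k _ => hs1 _ _ _).trans ?_)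
    simp
  set G : ι → (ι → 𝒳) → ℝ := fun k x =>
    (∫ y, s (τ x) y k ^ 2 ∂(ν k)) + 2 * s (τ x) (x k) k with hG
  have hwm : ∀ k, Measurable fun x : ι → 𝒳 => ∫ y, s (τ x) y k ^ 2 ∂(ν k) := fun k =>
    (measurable_of_countable fun i => ∫ y, s i y k ^ 2 ∂(ν k)).comp hτ
  have hGm : ∀ k, Measurable (G k) := fun k => (hwm k).add ((hdm k).const_mul 2)
  have hsq1 : ∀ i x k, |s i x k ^ 2| ≤ 1 := fun i x k => by
    rw [abs_pow]; exact pow_le_one₀ (abs_nonneg _) (hs1 i x k)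
  have hG3 : ∀ k x, |G k x| ≤ 3 := fun k x => by
    have h1 : |∫ y, s (τ x) y k ^ 2 ∂(ν k)| ≤ 1 := abs_integral_le_of_abs_le fun y => hsq1 _ _ _
    have h2 := hs1 (τ x) (x k) k
    rw [abs_le] at h1 h2 ⊢
    constructor <;> simp only [hG] <;> linarith
  have hGu : ∀ k, Integrable (fun p : (ι → 𝒳) × 𝒳 => G k (Function.update p.1 k p.2))
      ((Measure.pi ν).prod (ν k)) := fun k =>
    integrable_of_abs_le ((hGm k).comp (measurable_update_prod k)) 3 fun p => hG3 _ _
  have hk : ∀ k, ∫ x, variance (fun y => ∑ j, s (τ (Function.update x k y))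
      (Function.update x k y j) j) (ν k) ∂(Measure.pi ν) ≤ ∫ x, G k x ∂(Measure.pi ν) := by
    intro k
    -- Resampling coordinate `k` preserves the law, so the one-variable bound can be applied for
    -- each frozen `x`.
    rw [← (measurePreserving_update ν k).integral_comp_measurable (hGm k),
      integral_prod _ (hGu k)]
    -- Nonnegativity spares a proof that the conditional variance is integrable.
    refine integral_mono_of_nonneg (ae_of_all _ fun x => variance_nonneg _ _)
      (hGu k).integral_prod_left (ae_of_all _ fun x => ?_)
    have hsplit : ∀ i y, ∑ j, s i (Function.update x k y j) j =
        (∑ j ∈ Finset.univ.erase k, s i (x j) j) + s i y k := fun i y => by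
      rw [← Finset.sum_erase_add _ _ (Finset.mem_univ k), Function.update_self]
      congr 1
      refine Finset.sum_congr rfl fun j hj => ?_
      rw [Function.update_of_ne (Finset.ne_of_mem_erase hj)]
    have h := variance_le_of_forall_le_selection (ν k)
      (a := fun i => ∑ j ∈ Finset.univ.erase k, s i (x j) j) (φ := fun i y => s i y k)
      (τ := fun y => τ (Function.update x k y)) (fun i => hsum _ i x) (fun i => hsk i k)
      (fun i y => hs1 i y k) (fun i => hs0 i k)
      (hτ.comp ((measurable_update_prod k).comp measurable_prodMk_left))
      (fun y y' => by
        rw [← hsplit, ← hsplit]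
        exact hmax _ _)
    simpa only [hsplit, hG, Function.update_self] using h
  have hfm : Measurable fun x : ι → 𝒳 => ∑ k, s (τ x) (x k) k :=
    Finset.measurable_sum _ fun k _ => hdm k
  refine (variance_le_sum_integral_variance_update ν hfm fun x => hsum Finset.univ _ x).trans
    ((Finset.sum_le_sum fun k _ => hk k).trans ?_)
  rw [← integral_finsetSum _ fun k _ => integrable_of_abs_le (hGm k) 3 (hG3 k)]
  have hfi : Integrable (fun x : ι → 𝒳 => ∑ k, s (τ x) (x k) k) (Measure.pi ν) :=
    integrable_of_abs_le hfm _ fun x => hsum Finset.univ _ x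
  calc ∫ x, ∑ k, G k x ∂(Measure.pi ν)
      ≤ ∫ x, (V + 2 * ∑ k, s (τ x) (x k) k) ∂(Measure.pi ν) := by
        refine integral_mono
          (integrable_finsetSum _ fun k _ => integrable_of_abs_le (hGm k) 3 (hG3 k))
          ((integrable_const V).add (hfi.const_mul 2)) fun x => ?_
        simp only [hG, Finset.sum_add_distrib, ← Finset.mul_sum]
        linarith [hV (τ x)]
    _ = V + 2 * ∫ x, ∑ k, s (τ x) (x k) k ∂(Measure.pi ν) := by
        rw [integral_add (integrable_const V) (hfi.const_mul 2), integral_const_mul]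
        simp

/-! ### From finite to countable classes -/

/-- A countable supremum need not be attained, so the selection is made among the first `N + 1`
indices; a tie keeps the earlier choice. -/
theorem exists_measurable_argmax {α : Type*} [MeasurableSpace α] {F : ℕ → α → ℝ}
    (hF : ∀ i, Measurable (F i)) (N : ℕ) :
    ∃ τ : α → ℕ, Measurable τ ∧ (∀ x, τ x ≤ N) ∧ ∀ x, ∀ i ≤ N, F i x ≤ F (τ x) x := by
  have hFu : Measurable fun p : ℕ × α => F p.1 p.2 := measurable_from_prod_countable_right hF
  induction N with
  | zero => exact ⟨fun _ => 0, measurable_const, fun _ => le_rfl, fun x i hi => by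
      rw [Nat.le_zero.1 hi]⟩
  | succ N ih =>
    obtain ⟨τ, hτ, hτN, hmax⟩ := ih
    classical
    refine ⟨fun x => if F (τ x) x < F (N + 1) x then N + 1 else τ x, ?_, fun x => ?_,
      fun x i hi => ?_⟩
    · exact Measurable.ite (measurableSet_lt (hFu.comp (hτ.prodMk measurable_id)) (hF _))
        measurable_const hτ
    · have := hτN x
      dsimp only
      split_ifs <;> omega
    · dsimp only
      rcases Nat.le_succ_iff.1 hi with h | h
      · have := hmax x i h
        split_ifs <;> linarith
      · subst h
        split_ifs <;> linarith

end EmpiricalProcess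

open EmpiricalProcess

theorem corollary1p1 {Ω : Type*} [MeasurableSpace Ω] (μ : Measure Ω) [IsProbabilityMeasure μ]
    {𝒳 : Type*} [TopologicalSpace 𝒳] [PolishSpace 𝒳] [MeasurableSpace 𝒳] [BorelSpace 𝒳]
    (n : ℕ) (X : Fin n → Ω → 𝒳) (hX : ∀ k, Measurable (X k)) (hindep : iIndepFun X μ)
    (𝒮 : Set (𝒳 → Fin n → ℝ)) (hcount : 𝒮.Countable) (hne : 𝒮.Nonempty)
    (hmeas : ∀ s ∈ 𝒮, Measurable s)
    (hbound : ∀ s ∈ 𝒮, ∀ x k, s x k ∈ Set.Icc (-1 : ℝ) 1)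
    (hcent : ∀ s ∈ 𝒮, ∀ k, ∫ ω, s (X k ω) k ∂μ = 0) :
    variance (EmpiricalProcess.supremum X 𝒮) μ ≤
      EmpiricalProcess.maxVariance μ X 𝒮 + 2 * ∫ ω, EmpiricalProcess.supremum X 𝒮 ω ∂μ := by
  obtain ⟨s, rfl⟩ := hcount.exists_eq_range hne
  have hs : ∀ i, Measurable (s i) := fun i => hmeas _ ⟨i, rfl⟩
  have hs1 : ∀ i x k, |s i x k| ≤ 1 := fun i x k => abs_le.2 (hbound _ ⟨i, rfl⟩ x k)
  have hsk : ∀ i k, Measurable fun x => s i x k := fun i k => (measurable_pi_apply k).comp (hs i)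
  set ν : Fin n → Measure 𝒳 := fun k => μ.map (X k) with hν
  have hprob : ∀ k, IsProbabilityMeasure (ν k) := fun k =>
    Measure.isProbabilityMeasure_map (hX k).aemeasurable
  have hs0 : ∀ i k, ∫ x, s i x k ∂(ν k) = 0 := fun i k => by
    rw [integral_map (hX k).aemeasurable (hsk i k).aestronglyMeasurable]
    exact hcent _ ⟨i, rfl⟩ k
  have hXm : Measurable fun ω k => X k ω := measurable_pi_lambda _ hX
  have hpi : MeasurePreserving (fun ω k => X k ω) μ (Measure.pi ν) :=
    ⟨hXm, (iIndepFun_iff_map_fun_eq_pi_map fun k => (hX k).aemeasurable).1 hindep⟩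
  have hSm : ∀ i, Measurable (partialSum X (s i)) := fun i =>
    Finset.measurable_sum _ fun k _ => (hsk i k).comp (hX k)
  have hSn : ∀ i ω, |partialSum X (s i) ω| ≤ n := fun i ω => by
    refine (Finset.abs_sum_le_sum_abs _ _).trans ((Finset.sum_le_sum fun k _ => hs1 _ _ _).trans ?_)
    simp
  have hbdd : ∀ ω, BddAbove (Set.range fun i => partialSum X (s i) ω) := fun ω =>
    ⟨n, by rintro _ ⟨i, rfl⟩; exact (abs_le.1 (hSn i ω)).2⟩
  have hZ : ∀ ω, supremum X (Set.range s) ω = ⨆ i, partialSum X (s i) ω := fun ω =>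
    iSup_range' (fun f : 𝒳 → Fin n → ℝ => partialSum X f ω) s
  have hvar : ∀ i, variance (partialSum X (s i)) μ = ∑ k, ∫ x, s i x k ^ 2 ∂(ν k) := by
    intro i
    have hmem : ∀ k, MemLp (fun ω => s i (X k ω) k) 2 μ := fun k =>
      memLp_two_of_abs_le ((hsk i k).comp (hX k)) 1 fun ω => hs1 _ _ _
    have e : partialSum X (s i) = ∑ k, fun ω => s i (X k ω) k := by
      funext ω; simp [partialSum]
    rw [e, IndepFun.variance_sum fun k _ => hmem k]
    · refine Finset.sum_congr rfl fun k _ => ?_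
      rw [variance_of_integral_eq_zero (hmem k).aemeasurable (hcent _ ⟨i, rfl⟩ k),
        integral_map (hX k).aemeasurable ((hsk i k).pow_const 2).aestronglyMeasurable]
    · intro k _ l _ hkl
      exact (hindep.indepFun hkl).comp (hsk i k) (hsk i l)
  have hV : ∀ i, ∑ k, ∫ x, s i x k ^ 2 ∂(ν k) ≤ maxVariance μ X (Set.range s) := fun i => by
    rw [← hvar]
    refine le_ciSup (f := fun t : Set.range s => variance (partialSum X t) μ) ⟨n, ?_⟩ ⟨s i, i, rfl⟩
    rintro _ ⟨⟨_, j, rfl⟩, rfl⟩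
    dsimp only
    rw [hvar]
    have h1 : ∀ k ∈ Finset.univ, ∫ x, s j x k ^ 2 ∂(ν k) ≤ 1 := fun k _ =>
      (le_abs_self _).trans (abs_integral_le_of_abs_le fun x => by
        rw [abs_pow]; exact pow_le_one₀ (abs_nonneg _) (hs1 j x k))
    simpa using Finset.sum_le_sum h1
  choose τ hτ hτN hmax using exists_measurable_argmax
    (F := fun i (x : Fin n → 𝒳) => ∑ k, s i (x k) k)
    fun i => Finset.measurable_sum _ fun k _ => (hsk i k).comp (measurable_pi_apply k)
  -- `W N` is the maximum over `s 0, …, s N`, on the product space; `Z N` is its pullback to `Ω`.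
  set W : ℕ → (Fin n → 𝒳) → ℝ := fun N x => ∑ k, s (τ N x) (x k) k with hW
  have hWm : ∀ N, Measurable (W N) := fun N => Finset.measurable_sum _ fun k _ =>
    (measurable_from_prod_countable_right fun i => hsk i k : Measurable fun p : ℕ × 𝒳 =>
      s p.1 p.2 k).comp ((hτ N).prodMk (measurable_pi_apply k))
  set Z : ℕ → Ω → ℝ := fun N ω => W N fun k => X k ω with hZN
  have hZm : ∀ N, Measurable (Z N) := fun N => (hWm N).comp hXm
  have hZn : ∀ N ω, |Z N ω| ≤ n := fun N ω => hSn (τ N fun k => X k ω) ω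
  have hfin : ∀ N, variance (Z N) μ ≤
      maxVariance μ X (Set.range s) + 2 * ∫ ω, Z N ω ∂μ := fun N => by
    have h := variance_selection_le ν hs hs1 hs0 (hτ N)
      (fun x x' => hmax N x _ (hτN N x')) hV
    rw [← hpi.integral_comp_measurable (hWm N), ← hpi.map_eq,
      variance_map (hWm N).aemeasurable hXm.aemeasurable] at h
    exact h
  -- `Z N` is itself one of the sums, hence at most the supremum, and it dominates the `i`-th sum
  -- once `N ≥ i`.
  have hlim : ∀ ω, Filter.Tendsto (fun N => Z N ω) Filter.atTop
      (nhds (supremum X (Set.range s) ω)) := fun ω => by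
    rw [hZ]
    have hle : ∀ i N, i ≤ N → partialSum X (s i) ω ≤ Z N ω := fun i N h => hmax N _ i h
    refine tendsto_order.2 ⟨fun b hb => ?_, fun b hb => Filter.Eventually.of_forall fun N =>
      (le_ciSup (hbdd ω) (τ N fun k => X k ω)).trans_lt hb⟩
    obtain ⟨i, hi⟩ := exists_lt_of_lt_ciSup hb
    filter_upwards [Filter.eventually_ge_atTop i] with N hN
    exact hi.trans_le (hle i N hN)
  have hsupm : Measurable (supremum X (Set.range s)) :=
    measurable_of_tendsto_metrizable hZm (tendsto_pi_nhds.2 hlim)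
  have hsupn : ∀ ω, |supremum X (Set.range s) ω| ≤ n := fun ω =>
    le_of_tendsto (hlim ω).abs (Filter.Eventually.of_forall fun N => hZn N ω)
  have hint : Filter.Tendsto (fun N => ∫ ω, Z N ω ∂μ) Filter.atTop
      (nhds (∫ ω, supremum X (Set.range s) ω ∂μ)) :=
    tendsto_integral_of_dominated_convergence (fun _ => (n : ℝ))
      (fun N => (hZm N).aestronglyMeasurable) (integrable_const _)
      (fun N => ae_of_all _ (hZn N)) (ae_of_all _ hlim)
  have hint2 : Filter.Tendsto (fun N => ∫ ω, Z N ω ^ 2 ∂μ) Filter.atTop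
      (nhds (∫ ω, supremum X (Set.range s) ω ^ 2 ∂μ)) :=
    tendsto_integral_of_dominated_convergence (fun _ => (n : ℝ) ^ 2)
      (fun N => ((hZm N).pow_const 2).aestronglyMeasurable) (integrable_const _)
      (fun N => ae_of_all _ fun ω => by
        rw [norm_pow]; exact pow_le_pow_left₀ (norm_nonneg _) (hZn N ω) 2)
      (ae_of_all _ fun ω => (hlim ω).pow 2)
  have hvarlim : Filter.Tendsto (fun N => variance (Z N) μ) Filter.atTop
      (nhds (variance (supremum X (Set.range s)) μ)) := by
    rw [variance_eq_sub (memLp_two_of_abs_le hsupm n hsupn)]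
    refine (hint2.sub (hint.pow 2)).congr fun N => ?_
    rw [variance_eq_sub (memLp_two_of_abs_le (hZm N) n (hZn N))]
    rfl
  exact le_of_tendsto_of_tendsto' hvarlim ((hint.const_mul 2).const_add _) hfin
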